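/- Let $\mathbb O'=\mathbb H\oplus\mathbb H$ be the para-octonions (split octonions), with multiplication $(q_1,q_2)(p_1,p_2)=(q_1p_1+\overline{p_2}q_2,\;p_2q_1+q_2\overline{p_1})$, conjugation $\overline{(q_1,q_2)}=(\overline{q_1},-q_2)$, real part $\mathrm{Re}(q_1,q_2)=\mathrm{Re}\,q_1$, inner product $\langle a,b\rangle=\mathrm{Re}[a\bar b]$ (of signature $(4,4)$) and $|a|^2=\langle a,a\rangle$. Put $$U_1=\{(1,y,z)\},\quad U_2=\{(x,1,z)\},\quad U_3=\{(x,y,1)\},$$ where in each case the triple in $\mathbb O'^3$ is required to satisfy $|x|^2+|y|^2+|z|^2>0$ (with the entry $1$ in its place), and let $\mathcal U=U_1\cup U_2\cup U_3$. For $p,q\in\mathcal U$ write $p\sim q$ if there is $\lambda\in\mathbb O'$ with $|\lambda|^2>0$ and $p_i=q_i\lambda$ for $i=1,2,3$; this is an equivalence relation. The para-octonionic projective plane is $\mathbb O'P^2=\mathcal U/{\sim}$; it is a $16$-dimensional smooth manifold with the three charts $U_i/{\sim}\to\mathbb O'^2$, $[1,u,v]\mapsto(u,v)$, $[u,1,v]\mapsto(u,v)$,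 $[u,v,1]\mapsto(u,v)$. It carries the semi-Riemannian metric which in each of these charts is $$ds^2=\frac{|du|^2(1+|v|^2)+|dv|^2(1+|u|^2)-2\,\mathrm{Re}[(u\bar v)(dv\,d\bar u)]}{(1+|u|^2+|v|^2)^2}.$$ Let $R(X,Y,Z,W)=g(R(X,Y)Z,W)$ be its Riemann curvature tensor, with the sign convention $R(X,Y)Z=\nabla_Y\nabla_XZ-\nabla_X\nabla_YZ+\nabla_{[X,Y]}Z$, and identify the tangent space at $P_0=[1,0,0]$ with $\mathbb O'^2$ by letting $(a,b)$ correspond to the tangent vector with coordinates $(a,b)$ in the chart $[1,u,v]\mapsto(u,v)$. Then for all $a,b,c,d,e,f,g,h\in\mathbb O'$, at the point $P_0$, $$\begin{aligned} R\big((a,b),(c,d),(e,f),(g,h)\big)=\;&4\langle a,e\rangle\langle c,g\rangle-4\langle c,e\rangle\langle a,g\rangle+4\langle b,f\rangle\langle d,h\rangle-4\langle d,f\rangle\langle b,h\rangle\\ &-\langle e\bar d,g\bar b\rangle+\langle e\bar b,g\bar d\rangle-\langle c\bar f,a\bar h\rangle+\langle a\bar f,c\bar h\rangle\\ &-\langle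 a\bar d-c\bar b,\;g\bar f-e\bar h\rangle. \end{aligned}$$ -/

import Mathlib

open scoped Quaternion Manifold ContDiff Topology

noncomputable section

/-- The para-octonions as a real vector space: `ℍ ⊕ ℍ`. -/
def ParaOctonion : Type := ℍ[ℝ] × ℍ[ℝ]

namespace ParaOctonion

instance : NormedAddCommGroup ParaOctonion := inferInstanceAs (NormedAddCommGroup (ℍ[ℝ] × ℍ[ℝ]))

instance : NormedSpace ℝ ParaOctonion := inferInstanceAs (NormedSpace ℝ (ℍ[ℝ] × ℍ[ℝ]))

instance : FiniteDimensional ℝ ParaOctonion :=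
  inferInstanceAs (FiniteDimensional ℝ (ℍ[ℝ] × ℍ[ℝ]))

/-- The Cayley–Dickson type product
`(q₁, q₂) (p₁, p₂) = (q₁ p₁ + p̄₂ q₂, p₂ q₁ + q₂ p̄₁)`. -/
instance : Mul ParaOctonion :=
  ⟨fun q p => (q.1 * p.1 + star p.2 * q.2, p.2 * q.1 + q.2 * star p.1)⟩

/-- The unit `(1, 0)`. -/
instance : One ParaOctonion := ⟨((1 : ℍ[ℝ]), (0 : ℍ[ℝ]))⟩

/-- Conjugation `(q₁, q₂) ↦ (q̄₁, -q₂)`. -/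
def conj (a : ParaOctonion) : ParaOctonion := (star a.1, -a.2)

/-- The real part. -/
def re (a : ParaOctonion) : ℝ := a.1.re

/-- The inner product `⟨a, b⟩ = Re (a b̄)`, of signature `(4, 4)`. -/
def ip (a b : ParaOctonion) : ℝ := re (a * conj b)

/-- The quadratic form `|a|² = ⟨a, a⟩`, which may be negative. -/
def nsq (a : ParaOctonion) : ℝ := ip a a

/-- The inverse `ā / |a|²`; used only where `|a|² > 0`. -/
def inv (a : ParaOctonion) : ParaOctonion := (nsq a)⁻¹ • conj a

theorem ext' {a b : ParaOctonion} (h₀ : a.1.re = b.1.re) (h₁ : a.1.imI = b.1.imI)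
    (h₂ : a.1.imJ = b.1.imJ) (h₃ : a.1.imK = b.1.imK) (h₄ : a.2.re = b.2.re)
    (h₅ : a.2.imI = b.2.imI) (h₆ : a.2.imJ = b.2.imJ) (h₇ : a.2.imK = b.2.imK) : a = b :=
  Prod.ext (Quaternion.ext _ _ h₀ h₁ h₂ h₃) (Quaternion.ext _ _ h₄ h₅ h₆ h₇)

theorem fst_mul (a b : ParaOctonion) : (a * b).1 = a.1 * b.1 + star b.2 * a.2 := rfl
theorem snd_mul (a b : ParaOctonion) : (a * b).2 = b.2 * a.1 + a.2 * star b.1 := rfl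
theorem fst_one : (1 : ParaOctonion).1 = 1 := rfl
theorem snd_one : (1 : ParaOctonion).2 = 0 := rfl
theorem fst_zero : (0 : ParaOctonion).1 = 0 := rfl
theorem snd_zero : (0 : ParaOctonion).2 = 0 := rfl
theorem fst_add (a b : ParaOctonion) : (a + b).1 = a.1 + b.1 := rfl
theorem snd_add (a b : ParaOctonion) : (a + b).2 = a.2 + b.2 := rfl
theorem fst_sub (a b : ParaOctonion) : (a - b).1 = a.1 - b.1 := rfl
theorem snd_sub (a b : ParaOctonion) : (a - b).2 = a.2 - b.2 := rfl
theorem fst_smul (r : ℝ) (a : ParaOctonion) : (r • a).1 = r • a.1 := rfl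
theorem snd_smul (r : ℝ) (a : ParaOctonion) : (r • a).2 = r • a.2 := rfl
theorem fst_conj (a : ParaOctonion) : (conj a).1 = star a.1 := rfl
theorem snd_conj (a : ParaOctonion) : (conj a).2 = -a.2 := rfl

theorem ip_eq (a b : ParaOctonion) : ip a b =
    a.1.re * b.1.re + a.1.imI * b.1.imI + a.1.imJ * b.1.imJ + a.1.imK * b.1.imK
      - a.2.re * b.2.re - a.2.imI * b.2.imI - a.2.imJ * b.2.imJ - a.2.imK * b.2.imK := by
  simp [ip, re, fst_mul, fst_conj, snd_conj]
  ring

theorem nsq_eq (a : ParaOctonion) : nsq a =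
    a.1.re ^ 2 + a.1.imI ^ 2 + a.1.imJ ^ 2 + a.1.imK ^ 2
      - a.2.re ^ 2 - a.2.imI ^ 2 - a.2.imJ ^ 2 - a.2.imK ^ 2 := by
  rw [nsq, ip_eq]; ring

theorem one_mul' (a : ParaOctonion) : 1 * a = a := by
  apply ext' <;> simp [fst_mul, snd_mul, fst_one, snd_one]

theorem mul_one' (a : ParaOctonion) : a * 1 = a := by
  apply ext' <;> simp [fst_mul, snd_mul, fst_one, snd_one]

theorem mul_add' (a b c : ParaOctonion) : a * (b + c) = a * b + a * c := by
  apply ext' <;> simp [fst_mul, snd_mul, fst_add, snd_add] <;> ring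

theorem add_mul' (a b c : ParaOctonion) : (a + b) * c = a * c + b * c := by
  apply ext' <;> simp [fst_mul, snd_mul, fst_add, snd_add] <;> ring

theorem smul_mul' (r : ℝ) (a b : ParaOctonion) : (r • a) * b = r • (a * b) := by
  apply ext' <;> simp [fst_mul, snd_mul, fst_smul, snd_smul]

theorem mul_smul' (r : ℝ) (a b : ParaOctonion) : a * (r • b) = r • (a * b) := by
  apply ext' <;> simp [fst_mul, snd_mul, fst_smul, snd_smul]

theorem mul_mul_conj (a b : ParaOctonion) : (a * b) * conj b = nsq b • a := by
  rw [nsq_eq]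
  apply ext' <;> simp [fst_mul, snd_mul, fst_conj, snd_conj, fst_smul, snd_smul] <;> ring

theorem mul_conj_mul (a b : ParaOctonion) : (a * conj b) * b = nsq b • a := by
  rw [nsq_eq]
  apply ext' <;> simp [fst_mul, snd_mul, fst_conj, snd_conj, fst_smul, snd_smul] <;> ring

theorem conj_conj (a : ParaOctonion) : conj (conj a) = a := by
  apply ext' <;> simp [fst_conj, snd_conj]

theorem conj_add (a b : ParaOctonion) : conj (a + b) = conj a + conj b := by
  apply ext' <;> simp [fst_conj, snd_conj, fst_add, snd_add] <;> ring

theorem conj_smul (r : ℝ) (a : ParaOctonion) : conj (r • a) = r • conj a := by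
  apply ext' <;> simp [fst_conj, snd_conj, fst_smul, snd_smul]

theorem conj_mul (a b : ParaOctonion) : conj (a * b) = conj b * conj a := by
  apply ext' <;> simp [fst_mul, snd_mul, fst_conj, snd_conj]

theorem nsq_mul (a b : ParaOctonion) : nsq (a * b) = nsq a * nsq b := by
  simp only [nsq_eq, fst_mul, snd_mul]
  simp
  ring

theorem nsq_conj (a : ParaOctonion) : nsq (conj a) = nsq a := by
  simp [nsq_eq, fst_conj, snd_conj]

theorem nsq_smul (r : ℝ) (a : ParaOctonion) : nsq (r • a) = r ^ 2 * nsq a := by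
  simp [nsq_eq, fst_smul, snd_smul]; ring

theorem nsq_one : nsq 1 = 1 := by simp [nsq_eq, fst_one, snd_one]

theorem nsq_zero : nsq 0 = 0 := by simp [nsq_eq, fst_zero, snd_zero]

theorem conj_one : conj 1 = 1 := by apply ext' <;> simp [fst_conj, snd_conj, fst_one, snd_one]

theorem inv_one : inv 1 = 1 := by simp [inv, nsq_one, conj_one]

theorem nsq_inv {a : ParaOctonion} (h : 0 < nsq a) : nsq (inv a) = (nsq a)⁻¹ := by
  rw [inv, nsq_smul, nsq_conj]; field_simp

theorem mul_mul_inv (a : ParaOctonion) {b : ParaOctonion} (h : 0 < nsq b) :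
    (a * b) * inv b = a := by
  rw [inv, mul_smul', mul_mul_conj, smul_smul, inv_mul_cancel₀ h.ne', one_smul]

theorem mul_inv_mul (a : ParaOctonion) {b : ParaOctonion} (h : 0 < nsq b) :
    (a * inv b) * b = a := by
  rw [inv, mul_smul', smul_mul', mul_conj_mul, smul_smul, inv_mul_cancel₀ h.ne', one_smul]

theorem mul_inv' {b : ParaOctonion} (h : 0 < nsq b) : b * inv b = 1 := by
  simpa [one_mul'] using mul_mul_inv 1 h

theorem inv_mul' {b : ParaOctonion} (h : 0 < nsq b) : inv b * b = 1 := by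
  simpa [one_mul'] using mul_inv_mul 1 h

theorem inv_nsq_pos {a : ParaOctonion} (h : 0 < nsq a) : 0 < nsq (inv a) := by
  rw [nsq_inv h]; positivity

/-- The inner product is bilinear; needed to regard the metric as a tensor field. -/
theorem ip_add_left (a b c : ParaOctonion) : ip (a + b) c = ip a c + ip b c := by
  simp [ip_eq, fst_add, snd_add]; ring
theorem ip_add_right (a b c : ParaOctonion) : ip a (b + c) = ip a b + ip a c := by
  simp [ip_eq, fst_add, snd_add]; ring
theorem ip_smul_left (r : ℝ) (a c : ParaOctonion) : ip (r • a) c = r * ip a c := by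
  simp [ip_eq, fst_smul, snd_smul]; ring
theorem ip_smul_right (r : ℝ) (a c : ParaOctonion) : ip a (r • c) = r * ip a c := by
  simp [ip_eq, fst_smul, snd_smul]; ring

theorem ip_comm (a b : ParaOctonion) : ip a b = ip b a := by
  simp only [ip_eq]; ring

theorem ip_conj_conj (a b : ParaOctonion) : ip (conj a) (conj b) = ip a b := by
  simp [ip_eq, fst_conj, snd_conj]

theorem ip_mul_conj_left (a b c : ParaOctonion) : ip (a * conj b) c = ip a (c * b) := by
  simp only [ip_eq, fst_mul, snd_mul, fst_conj, snd_conj]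
  simp
  ring

theorem ip_mul_mul_right (a b c : ParaOctonion) : ip (a * c) (b * c) = nsq c * ip a b := by
  rw [← ip_mul_conj_left, mul_mul_conj, ip_smul_left]

theorem ip_mul_mul_left (a b c : ParaOctonion) : ip (c * a) (c * b) = nsq c * ip a b := by
  rw [← ip_conj_conj, conj_mul, conj_mul, ip_mul_mul_right, nsq_conj, ip_conj_conj]

theorem nsq_add (a b : ParaOctonion) : nsq (a + b) = nsq a + 2 * ip a b + nsq b := by
  simp only [nsq, ip_add_left, ip_add_right, ip_comm b a]; ring

/-- Polarization of `|a b|² = |a|² |b|²` in both arguments. -/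
theorem ip_exchange (a b c d : ParaOctonion) :
    ip (a * b) (c * d) + ip (a * d) (c * b) = 2 * ip a c * ip b d := by
  have h := ip_mul_mul_right a c (b + d)
  simp only [mul_add', ip_add_left, ip_add_right, ip_mul_mul_right, nsq_add] at h
  linarith

end ParaOctonion

open ParaOctonion

namespace ParaOctonionicPlane

/-- `U i` consists of the triples with `i`-th coordinate `1` and `|x|² + |y|² + |z|² > 0`. -/
def U (i : Fin 3) : Set (Fin 3 → ParaOctonion) := {p | p i = 1 ∧ 0 < ∑ j, nsq (p j)}

/-- The set of reduced homogeneous coordinates. -/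
def reduced : Set (Fin 3 → ParaOctonion) := ⋃ i, U i

/-- `p ∼ q` iff `p = q λ` for some para-octonion `λ` with `|λ|² > 0`. -/
def Rel (p q : Fin 3 → ParaOctonion) : Prop :=
  ∃ l : ParaOctonion, 0 < nsq l ∧ ∀ i, p i = q i * l

theorem mem_reduced {p : Fin 3 → ParaOctonion} :
    p ∈ reduced ↔ (∃ i, p i = 1) ∧ 0 < ∑ j, nsq (p j) := by
  simp [reduced, U]

theorem Rel.refl (p : Fin 3 → ParaOctonion) : Rel p p :=
  ⟨1, by simp [nsq_one], fun i => (mul_one' _).symm⟩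

theorem Rel.symm {p q : Fin 3 → ParaOctonion} (h : Rel p q) : Rel q p := by
  obtain ⟨l, hl, h⟩ := h
  exact ⟨inv l, inv_nsq_pos hl, fun i => by rw [h, mul_mul_inv _ hl]⟩

theorem Rel.eq_of_eq_one {p q : Fin 3 → ParaOctonion} (h : Rel p q) {i : Fin 3}
    (hp : p i = 1) (hq : q i = 1) : p = q := by
  obtain ⟨l, -, h⟩ := h
  have : l = 1 := by rw [← hp, h, hq, one_mul']
  funext j
  rw [h, this, mul_one']

theorem Rel.trans {p q r : Fin 3 → ParaOctonion} (hp : p ∈ reduced) (hq : q ∈ reduced)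
    (hr : r ∈ reduced) (h : Rel p q) (h' : Rel q r) : Rel p r := by
  obtain ⟨⟨i, hi⟩, -⟩ := mem_reduced.1 hp
  obtain ⟨⟨j, hj⟩, -⟩ := mem_reduced.1 hq
  obtain ⟨⟨k, hk⟩, -⟩ := mem_reduced.1 hr
  by_cases hij : i = j
  · subst hij; rwa [h.eq_of_eq_one hi hj]
  by_cases hjk : j = k
  · subst hjk; rwa [← h'.eq_of_eq_one hj hk]
  obtain ⟨l, hl, h⟩ := h
  obtain ⟨m, hm, h'⟩ := h'
  have hri : (r i * m) * l = 1 := by rw [← h', ← h, hi]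
  have hrj : r j * m = 1 := by rw [← h', hj]
  have hrjm : r j = inv m := by rw [← one_mul' (inv m), ← hrj, mul_mul_inv _ hm]
  have hrim : r i * m = inv l := by rw [← one_mul' (inv l), ← hri, mul_mul_inv _ hl]
  by_cases hik : i = k
  · subst hik
    refine ⟨1, by simp [nsq_one], fun n => ?_⟩
    rw [hk, one_mul'] at hri
    rw [hk, one_mul'] at hrim
    rw [h, h', mul_one', hrim, mul_inv_mul _ hl]
  refine ⟨m * l, by rw [nsq_mul]; positivity, fun n => ?_⟩
  have hn : n = i ∨ n = j ∨ n = k := by omega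
  rw [h, h']
  rcases hn with rfl | rfl | rfl
  · rw [hri]
    have h1 : r n = inv (m * l) := by
      rw [← mul_mul_inv (r n) hm, hrim, inv, inv, inv, conj_mul, nsq_mul, mul_smul', smul_mul',
        smul_smul, mul_inv]
    rw [h1, inv_mul' (by rw [nsq_mul]; positivity)]
  · rw [hrj, hrjm, one_mul']
    have := mul_mul_conj (conj l) (conj m)
    rw [conj_conj, ← conj_mul, nsq_conj] at this
    have := congrArg conj this
    rw [conj_mul, conj_conj] at this
    rw [inv, smul_mul', this]
    have e : conj (nsq m • conj l) = nsq m • l := by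
      apply ext' <;> simp [fst_conj, snd_conj, fst_smul, snd_smul]
    rw [e, smul_smul, inv_mul_cancel₀ hm.ne', one_smul]
  · rw [hk, one_mul', one_mul']

end ParaOctonionicPlane

open ParaOctonionicPlane in
/-- `∼` is an equivalence relation on reduced triples. -/
instance ParaOctonionicPlane.setoid : Setoid reduced where
  r p q := Rel p.1 q.1
  iseqv := ⟨fun p => Rel.refl p.1, fun h => h.symm, fun {p q r} h h' =>
    Rel.trans p.2 q.2 r.2 h h'⟩

/-- The para-octonionic projective plane, with the quotient topology. -/
def ParaOctonionicPlane : Type := Quotient ParaOctonionicPlane.setoid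

namespace ParaOctonionicPlane

instance : TopologicalSpace ParaOctonionicPlane :=
  inferInstanceAs (TopologicalSpace (Quotient ParaOctonionicPlane.setoid))

/-- The class `[x, y, z]` of a reduced triple. -/
def mk (p : reduced) : ParaOctonionicPlane := Quotient.mk setoid p

theorem isQuotientMap_mk : Topology.IsQuotientMap mk := isQuotientMap_quotient_mk'

theorem mk_surjective : Function.Surjective mk := Quotient.mk_surjective

theorem mk_eq_mk {p q : reduced} : mk p = mk q ↔ Rel p.1 q.1 := Quotient.eq (r := setoid)

/-- The coordinate space `𝕆' × 𝕆'`, of real dimension `16`. -/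
abbrev Model : Type := ParaOctonion × ParaOctonion

/-- Multiplication as a bilinear map. -/
def mulL : ParaOctonion →L[ℝ] ParaOctonion →L[ℝ] ParaOctonion :=
  (LinearMap.mk₂ ℝ (fun a b : ParaOctonion => a * b) add_mul' smul_mul' mul_add'
    mul_smul').toContinuousBilinearMap

/-- The inner product as a bilinear form. -/
def ipL : ParaOctonion →L[ℝ] ParaOctonion →L[ℝ] ℝ :=
  (LinearMap.mk₂ ℝ ip ip_add_left ip_smul_left ip_add_right
    ip_smul_right).toContinuousBilinearMap

/-- Conjugation as a linear map. -/
def conjL : ParaOctonion →L[ℝ] ParaOctonion :=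
  LinearMap.toContinuousLinearMap
    { toFun := conj, map_add' := conj_add, map_smul' := conj_smul }

theorem contDiff_mul : ContDiff ℝ ∞ (fun x : ParaOctonion × ParaOctonion => x.1 * x.2) :=
  mulL.isBoundedBilinearMap.contDiff

theorem contDiff_nsq : ContDiff ℝ ∞ nsq :=
  ipL.isBoundedBilinearMap.contDiff.comp (contDiff_id.prodMk contDiff_id)

theorem contDiffAt_inv {a : ParaOctonion} (h : 0 < nsq a) : ContDiffAt ℝ ∞ inv a :=
  (contDiff_nsq.contDiffAt.inv h.ne').smul conjL.contDiff.contDiffAt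

theorem continuous_nsq : Continuous nsq := contDiff_nsq.continuous

/-- The open set `1 + |u|² + |v|² > 0`. -/
def domain : Set Model := {x | 0 < 1 + nsq x.1 + nsq x.2}

/-- The triple with `1` in position `i` and `u`, `v` in the remaining positions, in this order. -/
def insertOne (i : Fin 3) (x : Model) : Fin 3 → ParaOctonion :=
  i.insertNth (α := fun _ => ParaOctonion) 1 ![x.1, x.2]

theorem insertOne_mem_U {i : Fin 3} {x : Model} (hx : x ∈ domain) : insertOne i x ∈ U i := by
  refine ⟨by simp [insertOne], ?_⟩
  rw [Fin.sum_univ_succAbove _ i]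
  simpa [insertOne, nsq_one, ← add_assoc, domain] using hx

theorem insertOne_mem {i : Fin 3} {x : Model} (hx : x ∈ domain) : insertOne i x ∈ reduced :=
  Set.mem_iUnion.2 ⟨i, insertOne_mem_U hx⟩

/-- Affine coordinates of a triple: divide by the `i`-th entry on the right. -/
def affine (i : Fin 3) (p : Fin 3 → ParaOctonion) : Model :=
  (p (i.succAbove 0) * inv (p i), p (i.succAbove 1) * inv (p i))

theorem insertOne_affine {i : Fin 3} {p : Fin 3 → ParaOctonion} (h : 0 < nsq (p i)) :
    insertOne i (affine i p) = fun j => p j * inv (p i) := by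
  funext j
  refine Fin.succAboveCases i ?_ (fun k => ?_) j
  · simp [insertOne, mul_inv' h]
  · fin_cases k <;> simp [insertOne, affine]

theorem affine_mem {i : Fin 3} {p : Fin 3 → ParaOctonion} (h : 0 < nsq (p i))
    (hp : p ∈ reduced) : affine i p ∈ domain := by
  have h1 := (mem_reduced.1 hp).2
  rw [Fin.sum_univ_succAbove _ i, Fin.sum_univ_two] at h1
  have : 1 + nsq (affine i p).1 + nsq (affine i p).2 =
      (nsq (p i))⁻¹ * (nsq (p i) + (nsq (p (i.succAbove 0)) + nsq (p (i.succAbove 1)))) := by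
    simp only [affine, nsq_mul, nsq_inv h]
    field_simp
    ring
  rw [domain, Set.mem_ofPred_eq, this]
  positivity

theorem rel_insertOne_affine {i : Fin 3} {p : Fin 3 → ParaOctonion} (h : 0 < nsq (p i)) :
    Rel (insertOne i (affine i p)) p :=
  ⟨inv (p i), inv_nsq_pos h, fun j => by rw [insertOne_affine h]⟩

theorem affine_insertOne (i : Fin 3) (x : Model) : affine i (insertOne i x) = x := by
  simp [affine, insertOne, inv_one, mul_one']

theorem Rel.nsq_pos_iff {p q : Fin 3 → ParaOctonion} (h : Rel p q) (i : Fin 3) :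
    0 < nsq (p i) ↔ 0 < nsq (q i) := by
  obtain ⟨l, hl, h⟩ := h
  rw [h, nsq_mul, mul_pos_iff_of_pos_right hl]

theorem Rel.affine_eq {p q : Fin 3 → ParaOctonion} (h : Rel p q) (hp : p ∈ reduced)
    (hq : q ∈ reduced) {i : Fin 3} (hi : 0 < nsq (p i)) : affine i p = affine i q := by
  have hi' := (h.nsq_pos_iff i).1 hi
  have mp := insertOne_mem (i := i) (affine_mem hi hp)
  have mq := insertOne_mem (i := i) (affine_mem hi' hq)
  have h1 : Rel (insertOne i (affine i p)) (insertOne i (affine i q)) :=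
    Rel.trans mp hq mq (Rel.trans mp hp hq (rel_insertOne_affine hi) h)
      (rel_insertOne_affine hi').symm
  have h2 := h1.eq_of_eq_one (i := i) (by simp [insertOne]) (by simp [insertOne])
  rw [← affine_insertOne i (affine i p), h2, affine_insertOne]

/-- `U i / ∼`. -/
def chartSource (i : Fin 3) : Set ParaOctonionicPlane :=
  {P | ∃ p : reduced, p.1 ∈ U i ∧ mk p = P}

theorem mk_mem_chartSource {i : Fin 3} {p : reduced} :
    mk p ∈ chartSource i ↔ 0 < nsq (p.1 i) := by
  constructor
  · rintro ⟨q, hq, h⟩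
    have h : Rel q.1 p.1 := mk_eq_mk.1 h
    rw [← h.nsq_pos_iff i, hq.1, nsq_one]
    exact one_pos
  · intro h
    exact ⟨⟨_, insertOne_mem (i := i) (affine_mem h p.2)⟩, insertOne_mem_U (affine_mem h p.2),
      mk_eq_mk.2 (rel_insertOne_affine h)⟩

open Classical in
/-- The coordinates `[x, y, z] ↦ (y, z), (x, z), (x, y)` on the respective `U i / ∼`: pass to the
representative in `U i` and drop the entry `1`. The value off `U i / ∼` is irrelevant. -/
def chartFun (i : Fin 3) : ParaOctonionicPlane → Model :=
  Quotient.lift (fun p : reduced => if 0 < nsq (p.1 i) then affine i p.1 else 0) (by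
    intro p q (h : Rel p.1 q.1)
    by_cases hi : 0 < nsq (p.1 i)
    · simp [hi, (h.nsq_pos_iff i).1 hi, h.affine_eq p.2 q.2 hi]
    · simp [hi, (h.nsq_pos_iff i).not.1 hi])

theorem chartFun_mk {i : Fin 3} {p : reduced} (h : 0 < nsq (p.1 i)) :
    chartFun i (mk p) = affine i p.1 := if_pos h

theorem zero_mem_domain : (0 : Model) ∈ domain := by simp [domain, nsq_zero]

open Classical in
/-- The inverse coordinates `(u, v) ↦ [1, u, v], [u, 1, v], [u, v, 1]`. The value off the domain is
irrelevant. -/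
def chartInv (i : Fin 3) (x : Model) : ParaOctonionicPlane :=
  if hx : x ∈ domain then mk ⟨insertOne i x, insertOne_mem hx⟩
  else mk ⟨insertOne i 0, insertOne_mem zero_mem_domain⟩

theorem chartInv_of_mem {i : Fin 3} {x : Model} (hx : x ∈ domain) :
    chartInv i x = mk ⟨insertOne i x, insertOne_mem hx⟩ := dif_pos hx

theorem isOpen_domain : IsOpen domain :=
  isOpen_lt continuous_const (by
    exact (continuous_const.add (continuous_nsq.comp continuous_fst)).add
      (continuous_nsq.comp continuous_snd))

theorem continuous_insertOne (i : Fin 3) : Continuous (insertOne i) := by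
  refine continuous_pi fun j => ?_
  refine Fin.succAboveCases i ?_ (fun k => ?_) j
  · simpa [insertOne] using continuous_const
  · fin_cases k <;> simp [insertOne] <;> fun_prop

theorem contDiffAt_affine (i : Fin 3) {p : Fin 3 → ParaOctonion} (h : 0 < nsq (p i)) :
    ContDiffAt ℝ ∞ (affine i) p := by
  have hi : ContDiffAt ℝ ∞ (fun p : Fin 3 → ParaOctonion => inv (p i)) p :=
    (contDiffAt_inv h).comp p (contDiff_apply ℝ ParaOctonion i).contDiffAt
  exact (contDiff_mul.contDiffAt.comp p
    ((contDiff_apply ℝ ParaOctonion (i.succAbove 0)).contDiffAt.prodMk hi)).prodMk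
    (contDiff_mul.contDiffAt.comp p
    ((contDiff_apply ℝ ParaOctonion (i.succAbove 1)).contDiffAt.prodMk hi))

/-- The `i`-th chart of the atlas. -/
def chart (i : Fin 3) : OpenPartialHomeomorph ParaOctonionicPlane Model where
  toFun := chartFun i
  invFun := chartInv i
  source := chartSource i
  target := domain
  map_source' := by
    rintro P hP
    obtain ⟨p, rfl⟩ := mk_surjective P
    have h := mk_mem_chartSource.1 hP
    rw [chartFun_mk h]
    exact affine_mem h p.2
  map_target' := by
    intro x hx
    rw [chartInv_of_mem hx]
    exact ⟨_, insertOne_mem_U hx, rfl⟩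
  left_inv' := by
    rintro P hP
    obtain ⟨p, rfl⟩ := mk_surjective P
    have h := mk_mem_chartSource.1 hP
    rw [chartFun_mk h, chartInv_of_mem (affine_mem h p.2)]
    exact mk_eq_mk.2 (rel_insertOne_affine h)
  right_inv' := by
    intro x hx
    rw [chartInv_of_mem hx, chartFun_mk (by simp [insertOne, nsq_one]), affine_insertOne]
  open_source := by
    rw [← isQuotientMap_mk.isOpen_preimage]
    have : mk ⁻¹' (chartSource i) = {p : reduced | 0 < nsq (p.1 i)} := by
      ext p; exact mk_mem_chartSource
    rw [this]
    exact isOpen_lt continuous_const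
      (continuous_nsq.comp ((continuous_apply i).comp continuous_subtype_val))
  open_target := isOpen_domain
  continuousOn_toFun := by
    have hs : mk ⁻¹' (chartSource i) = {p : reduced | 0 < nsq (p.1 i)} := by
      ext p; exact mk_mem_chartSource
    have ho : IsOpen {p : reduced | 0 < nsq (p.1 i)} := isOpen_lt continuous_const
      (continuous_nsq.comp ((continuous_apply i).comp continuous_subtype_val))
    rw [isQuotientMap_mk.continuousOn_isOpen_iff
      (by rw [← isQuotientMap_mk.isOpen_preimage, hs]; exact ho), hs]
    have : ContinuousOn (fun p : reduced => affine i p.1) {p : reduced | 0 < nsq (p.1 i)} :=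
      fun p hp => ((contDiffAt_affine i hp).continuousAt.comp
        continuous_subtype_val.continuousAt).continuousWithinAt
    exact this.congr fun p hp => chartFun_mk hp
  continuousOn_invFun := by
    rw [continuousOn_iff_continuous_domRestrict]
    have : Continuous fun x : domain => mk ⟨insertOne i x.1, insertOne_mem x.2⟩ :=
      isQuotientMap_mk.continuous.comp
        (((continuous_insertOne i).comp continuous_subtype_val).subtype_mk _)
    exact this.congr fun x => (chartInv_of_mem x.2).symm

theorem chart_apply (i : Fin 3) (P : ParaOctonionicPlane) : (chart i) P = chartFun i P := rfl

theorem chart_symm_apply (i : Fin 3) (x : Model) : (chart i).symm x = chartInv i x := rfl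

theorem chart_source (i : Fin 3) : (chart i).source = chartSource i := rfl

theorem chart_target (i : Fin 3) : (chart i).target = domain := rfl

theorem exists_mem_chartSource (P : ParaOctonionicPlane) : ∃ i, P ∈ chartSource i := by
  obtain ⟨p, rfl⟩ := mk_surjective P
  obtain ⟨i, hi⟩ := Set.mem_iUnion.1 p.2
  exact ⟨i, p, hi, rfl⟩

open Classical in
/-- The first index `i` with `P ∈ U i / ∼`. -/
def chartIndex (P : ParaOctonionicPlane) : Fin 3 :=
  Fin.find (fun i => P ∈ chartSource i) (exists_mem_chartSource P)

open Classical in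
theorem mem_chartIndex (P : ParaOctonionicPlane) : P ∈ chartSource (chartIndex P) :=
  Fin.find_spec (exists_mem_chartSource P)

/-- The atlas of the three charts. The preferred chart at a point is the first one around it. -/
instance : ChartedSpace Model ParaOctonionicPlane where
  atlas := Set.range chart
  chartAt P := chart (chartIndex P)
  mem_chart_source := mem_chartIndex
  chart_mem_atlas _ := ⟨_, rfl⟩

theorem chart_mem_atlas (i : Fin 3) : chart i ∈ atlas Model ParaOctonionicPlane := ⟨i, rfl⟩

theorem contDiff_insertOne (i : Fin 3) : ContDiff ℝ ∞ (insertOne i) := by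
  refine contDiff_pi.2 fun j => ?_
  refine Fin.succAboveCases i ?_ (fun k => ?_) j
  · simpa [insertOne] using contDiff_const
  · fin_cases k <;> simp [insertOne] <;> fun_prop

/-- The coordinate change from the `i`-th to the `j`-th chart. -/
theorem chart_chart_symm {i j : Fin 3} {x : Model} (hx : x ∈ domain)
    (hj : 0 < nsq (insertOne i x j)) : chart j ((chart i).symm x) = affine j (insertOne i x) := by
  rw [chart_apply, chart_symm_apply, chartInv_of_mem hx,
    chartFun_mk (p := ⟨insertOne i x, insertOne_mem hx⟩) hj]

theorem chart_symm_mem {i j : Fin 3} {x : Model} (hx : x ∈ domain) :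
    (chart i).symm x ∈ (chart j).source ↔ 0 < nsq (insertOne i x j) := by
  rw [chart_symm_apply, chart_source, chartInv_of_mem hx, mk_mem_chartSource]

instance : IsManifold 𝓘(ℝ, Model) ∞ ParaOctonionicPlane := by
  apply isManifold_of_contDiffOn
  rintro _ _ ⟨i, rfl⟩ ⟨j, rfl⟩ x hx
  have hx1 : x ∈ domain ∧ (chart i).symm x ∈ (chart j).source := by
    simpa [chart_target] using hx
  have hj := (chart_symm_mem hx1.1).1 hx1.2
  have h1 : ContDiffAt ℝ ∞ (fun x => affine j (insertOne i x)) x :=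
    (contDiffAt_affine j hj).comp x (contDiff_insertOne i).contDiffAt
  refine h1.contDiffWithinAt.congr_of_mem (fun y hy => ?_) hx
  have hy1 : y ∈ domain ∧ (chart i).symm y ∈ (chart j).source := by
    simpa [chart_target] using hy
  simpa using chart_chart_symm hy1.1 ((chart_symm_mem hy1.1).1 hy1.2)

end ParaOctonionicPlane

/-! Curvature of a semi-Riemannian metric, computed in a chart. -/

namespace SemiRiemannian

variable {E : Type*} [NormedAddCommGroup E] [NormedSpace ℝ E]

/-- The Christoffel symbols of the first kind of a metric `G` on an open subset of `E`:
`z ↦ ½ (∂_v G(w, z) + ∂_w G(v, z) - ∂_z G(v, w))`. -/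
def christoffelLower (G : E → E →L[ℝ] E →L[ℝ] ℝ) (x v w : E) : E →L[ℝ] ℝ :=
  (1 / 2 : ℝ) • (fderiv ℝ G x v w + fderiv ℝ G x w v - ((fderiv ℝ G x).flip v).flip w)

/-- The Christoffel symbols of the second kind, i.e. the vector `Γ(v, w)` with
`G(Γ(v, w), z) = christoffelLower G x v w z` for all `z`; the Levi-Civita connection is
`∇_v W = ∂_v W + Γ(v, W)`. -/
def christoffel (G : E → E →L[ℝ] E →L[ℝ] ℝ) (x v w : E) : E :=
  (G x).inverse (christoffelLower G x v w)

/-- The curvature operator, with the sign convention `R(X, Y) Z = ∇_Y ∇_X Z - ∇_X ∇_Y Z` for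
coordinate vector fields, i.e. `R_{αβγ}^δ = Γ_{αγ;β}^δ - Γ_{βγ;α}^δ + (terms quadratic in Γ)`. -/
def coordCurvature (G : E → E →L[ℝ] E →L[ℝ] ℝ) (x X Y Z : E) : E :=
  fderiv ℝ (fun y => christoffel G y X Z) x Y - fderiv ℝ (fun y => christoffel G y Y Z) x X
    + christoffel G x Y (christoffel G x X Z) - christoffel G x X (christoffel G x Y Z)

variable {M : Type*} [TopologicalSpace M] [ChartedSpace E M]

/-- The coordinate expression of a field of bilinear forms in a chart `e`. -/
def inChart (g : ∀ p : M, TangentSpace 𝓘(ℝ, E) p →L[ℝ] TangentSpace 𝓘(ℝ, E) p →L[ℝ] ℝ)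
    (e : OpenPartialHomeomorph M E) (x : E) : E →L[ℝ] E →L[ℝ] ℝ :=
  let B : E →L[ℝ] E →L[ℝ] ℝ := g (e.symm x)
  let d : E →L[ℝ] E := mfderiv 𝓘(ℝ, E) 𝓘(ℝ, E) e.symm x
  B.bilinearComp d d

/-- The Riemann curvature tensor `R(X, Y, Z, W) = g(R(X, Y) Z, W)` at a point `p`, computed in the
preferred chart at `p`. -/
def riemannTensor (g : ∀ p : M, TangentSpace 𝓘(ℝ, E) p →L[ℝ] TangentSpace 𝓘(ℝ, E) p →L[ℝ] ℝ)
    (p : M) (X Y Z W : TangentSpace 𝓘(ℝ, E) p) : ℝ :=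
  let e := chartAt E p
  let d : TangentSpace 𝓘(ℝ, E) p →L[ℝ] E := mfderiv 𝓘(ℝ, E) 𝓘(ℝ, E) e p
  inChart g e (e p) (coordCurvature (inChart g e) (e p) (d X) (d Y) (d Z)) (d W)

end SemiRiemannian

namespace ParaOctonionicPlane

/-- The line element
`ds² = (|du|² (1 + |v|²) + |dv|² (1 + |u|²) - 2 Re((u v̄)(dv dū))) / (1 + |u|² + |v|²)²`
at `x = (u, v)`, evaluated on `X = (du, dv)`. -/
def lineElement (x X : Model) : ℝ :=
  (nsq X.1 * (1 + nsq x.2) + nsq X.2 * (1 + nsq x.1)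
    - 2 * re ((x.1 * conj x.2) * (X.2 * conj X.1))) / (1 + nsq x.1 + nsq x.2) ^ 2

theorem re_add (a b : ParaOctonion) : re (a + b) = re a + re b := rfl

theorem re_smul (r : ℝ) (a : ParaOctonion) : re (r • a) = r * re a := rfl

/-- The symmetric bilinear form with quadratic form `ds²`. -/
def coordForm (x : Model) : Model →L[ℝ] Model →L[ℝ] ℝ :=
  (LinearMap.mk₂ ℝ (fun X Y : Model =>
    (ip X.1 Y.1 * (1 + nsq x.2) + ip X.2 Y.2 * (1 + nsq x.1)
      - re ((x.1 * conj x.2) * (X.2 * conj Y.1)) - re ((x.1 * conj x.2) * (Y.2 * conj X.1)))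
      / (1 + nsq x.1 + nsq x.2) ^ 2)
    (by
      intro X X' Y
      simp only [Prod.fst_add, Prod.snd_add, ip_add_left, add_mul', mul_add', conj_add, re_add]
      ring)
    (by
      intro r X Y
      simp only [Prod.smul_fst, Prod.smul_snd, ip_smul_left, smul_mul', mul_smul', conj_smul,
        re_smul, smul_eq_mul]
      ring)
    (by
      intro X Y Y'
      simp only [Prod.fst_add, Prod.snd_add, ip_add_right, add_mul', mul_add', conj_add, re_add]
      ring)
    (by
      intro r X Y
      simp only [Prod.smul_fst, Prod.smul_snd, ip_smul_right, smul_mul', mul_smul', conj_smul,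
        re_smul, smul_eq_mul]
      ring)).toContinuousBilinearMap

theorem coordForm_apply (x X Y : Model) : coordForm x X Y =
    (ip X.1 Y.1 * (1 + nsq x.2) + ip X.2 Y.2 * (1 + nsq x.1)
      - re ((x.1 * conj x.2) * (X.2 * conj Y.1)) - re ((x.1 * conj x.2) * (Y.2 * conj X.1)))
      / (1 + nsq x.1 + nsq x.2) ^ 2 := rfl

theorem coordForm_self (x X : Model) : coordForm x X X = lineElement x X := by
  rw [coordForm_apply, lineElement, nsq.eq_def X.1, nsq.eq_def X.2]; ring

theorem coordForm_symm (x X Y : Model) : coordForm x X Y = coordForm x Y X := by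
  rw [coordForm_apply, coordForm_apply, ip_comm X.1, ip_comm X.2]; ring

/-- The metric on `U i / ∼` given by `ds²` in the coordinates `(u, v)` of the `i`-th chart. -/
def chartMetric (i : Fin 3) (P : ParaOctonionicPlane) :
    TangentSpace 𝓘(ℝ, Model) P →L[ℝ] TangentSpace 𝓘(ℝ, Model) P →L[ℝ] ℝ :=
  let d : Model →L[ℝ] Model := mfderiv 𝓘(ℝ, Model) 𝓘(ℝ, Model) (chart i) P
  show Model →L[ℝ] Model →L[ℝ] ℝ from (coordForm (chart i P)).bilinearComp d d

/-- The metric of the para-octonionic projective plane. -/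
def metric (P : ParaOctonionicPlane) :
    TangentSpace 𝓘(ℝ, Model) P →L[ℝ] TangentSpace 𝓘(ℝ, Model) P →L[ℝ] ℝ :=
  chartMetric (chartIndex P) P

/-! The metrics on the three charts agree on the overlaps. -/

theorem re_mul_eq_ip (a b c d : ParaOctonion) :
    re ((a * conj b) * (c * conj d)) = ip (b * conj a) (c * conj d) := by
  rw [ip_comm, ip, conj_mul, conj_conj]
  have (p q : ParaOctonion) : re (p * q) = re (q * p) := by
    simp [re, fst_mul]; ring
  exact this _ _

theorem lineElement_swap (x X : Model) : lineElement x.swap X.swap = lineElement x X := by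
  simp only [lineElement, re_mul_eq_ip, Prod.fst_swap, Prod.snd_swap]
  rw [← ip_conj_conj (x.1 * _), conj_mul, conj_mul, conj_conj, conj_conj]
  ring

/-- The coordinate change `(x, z) ↦ (x⁻¹, z x⁻¹)`. -/
def transition (x : Model) : Model := (inv x.1, x.2 * inv x.1)

/-- The differential of the coordinate change. -/
def dtransition (x X : Model) : Model :=
  ((nsq x.1)⁻¹ • conj X.1 - (2 * ip x.1 X.1 * (nsq x.1 ^ 2)⁻¹) • conj x.1,
    X.2 * inv x.1 + x.2 *
      ((nsq x.1)⁻¹ • conj X.1 - (2 * ip x.1 X.1 * (nsq x.1 ^ 2)⁻¹) • conj x.1))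

theorem lineElement_transition {x : Model} (hx : 0 < nsq x.1) (hd : x ∈ domain) (X : Model) :
    lineElement (transition x) (dtransition x X) = lineElement x X := by
  obtain ⟨x, z⟩ := x
  obtain ⟨dx, dz⟩ := X
  simp only [lineElement, re_mul_eq_ip, transition, dtransition] at *
  set n := nsq x with hn
  set s := ip x dx with hs
  have hd' : 0 < 1 + n + nsq z := hd
  have hsub (a b : ParaOctonion) : a - b = a + (-1 : ℝ) • b := by simp [sub_eq_add_neg]
  have e1 : nsq (inv x) = n⁻¹ := nsq_inv hx
  have e2 : z * inv x * conj (inv x) = n⁻¹ • z := by rw [mul_mul_conj, e1]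
  have ex := ip_exchange dz (conj x) z (conj dx)
  rw [ip_conj_conj, ← hs] at ex
  have ex2 : ip (dz * conj x) (z * conj dx) = 2 * ip dz z * s - ip (z * conj x) (dz * conj dx) := by
    rw [ip_comm (z * conj x)]; linarith
  set c := ip (z * conj x) (dz * conj dx) with hc
  have e3 : nsq (n⁻¹ • conj dx - (2 * s * (n ^ 2)⁻¹) • conj x) = nsq dx * (n ^ 2)⁻¹ := by
    rw [hsub, nsq_add, nsq_smul, nsq_smul, nsq_smul, nsq_conj, nsq_conj, ip_smul_left,
      ip_smul_right, ip_smul_right, ip_conj_conj, ip_comm, ← hs, ← hn]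
    field_simp; ring
  set du := n⁻¹ • conj dx - (2 * s * (n ^ 2)⁻¹) • conj x with hdu
  have h1 : nsq (dz * inv x) = nsq dz * n⁻¹ := by rw [nsq_mul, e1]
  have h2 : nsq (z * du) = nsq z * (nsq dx * (n ^ 2)⁻¹) := by rw [nsq_mul, e3]
  have h3 : ip (dz * inv x) (z * du) = - c * (n ^ 2)⁻¹ := by
    rw [hdu, hsub, mul_add', inv, ← hn]
    simp only [mul_smul', ip_add_right, ip_smul_right, ip_smul_left, ex2, ip_mul_mul_right,
      nsq_conj, ← hn]
    field_simp; ring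
  have h4 : nsq (dz * inv x + z * du) =
      nsq dz * n⁻¹ + nsq z * (nsq dx * (n ^ 2)⁻¹) - 2 * c * (n ^ 2)⁻¹ := by
    rw [nsq_add, h1, h2, h3]; ring
  have h5 : ip (n⁻¹ • z) ((dz * inv x + z * du) * conj du) =
      n⁻¹ * (nsq z * (nsq dx * (n ^ 2)⁻¹) - c * (n ^ 2)⁻¹) := by
    rw [ip_smul_left, ip_comm, ip_mul_conj_left, ip_add_left, h3]
    have : ip (z * du) (z * du) = nsq z * (nsq dx * (n ^ 2)⁻¹) := h2
    rw [this]; ring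
  have h6 : 1 + n⁻¹ + nsq z * n⁻¹ = (1 + n + nsq z) * n⁻¹ := by field_simp; ring
  rw [e2, h5, h4, e3, nsq_mul, e1, h6]
  have h7 := hd'.ne'
  field_simp
  ring

theorem hasFDerivAt_inv {a : ParaOctonion} (h : 0 < nsq a) :
    HasFDerivAt inv ((nsq a)⁻¹ • conjL
      + (-((nsq a ^ 2)⁻¹) • ((2 : ℝ) • ipL a)).smulRight (conj a)) a := by
  have h1 : HasFDerivAt nsq ((2 : ℝ) • ipL a) a := by
    have := ipL.hasFDerivAt_of_bilinear (hasFDerivAt_id a) (hasFDerivAt_id a)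
    refine this.congr_fderiv ?_
    ext b
    simp only [_root_.add_apply, _root_.smul_apply, smul_eq_mul]
    change ip a b + ip b a = 2 * ip a b
    rw [ip_comm b a]; ring
  have h2 : HasFDerivAt (fun y => (nsq y)⁻¹) (-((nsq a ^ 2)⁻¹) • ((2 : ℝ) • ipL a)) a :=
    (hasDerivAt_inv h.ne').comp_hasFDerivAt a h1
  exact h2.smul conjL.hasFDerivAt

theorem hasFDerivAt_transition {x : Model} (hx : 0 < nsq x.1) :
    ∃ L : Model →L[ℝ] Model, HasFDerivAt transition L x ∧ ∀ X, L X = dtransition x X := by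
  have h1 : HasFDerivAt (fun y : Model => inv y.1) _ x :=
    HasFDerivAt.comp x (hasFDerivAt_inv hx) hasFDerivAt_fst
  have h2 := mulL.hasFDerivAt_of_bilinear (hasFDerivAt_snd (p := x) (𝕜 := ℝ)) h1
  refine ⟨_, h1.prodMk h2, fun X => ?_⟩
  have e : (nsq x.1)⁻¹ • conj X.1 + (-((nsq x.1 ^ 2)⁻¹) * (2 * ip x.1 X.1)) • conj x.1 =
      (nsq x.1)⁻¹ • conj X.1 - (2 * ip x.1 X.1 * (nsq x.1 ^ 2)⁻¹) • conj x.1 := by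
    rw [sub_eq_add_neg, ← neg_smul]; congr 2; ring
  rw [dtransition, ← e]
  refine Prod.ext rfl ?_
  exact add_comm _ _

/-- Every coordinate change is `(x, z) ↦ (x⁻¹, z x⁻¹)` up to the order of the two coordinates. -/
theorem affine_insertOne_cases {i j : Fin 3} (hij : i ≠ j) :
    ∃ σ τ : Model ≃L[ℝ] Model,
      (σ = .refl ℝ _ ∨ σ = .prodComm ℝ _ _) ∧ (τ = .refl ℝ _ ∨ τ = .prodComm ℝ _ _) ∧
      ∀ x, affine j (insertOne i x) = σ (transition (τ x)) ∧ insertOne i x j = (τ x).1 := by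
  let r : Model ≃L[ℝ] Model := .refl ℝ _
  let s : Model ≃L[ℝ] Model := .prodComm ℝ _ _
  have hr : ∀ x, r x = x := fun _ => rfl
  have hs : ∀ x, s x = x.swap := fun _ => rfl
  have key (σ τ : Model ≃L[ℝ] Model) (h1 : σ = r ∨ σ = s) (h2 : τ = r ∨ τ = s)
      (h : ∀ x, affine j (insertOne i x) = σ (transition (τ x)) ∧ insertOne i x j = (τ x).1) :=
    (⟨σ, τ, h1, h2, h⟩ : ∃ σ τ : Model ≃L[ℝ] Model, (σ = r ∨ σ = s) ∧ (τ = r ∨ τ = s) ∧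
      ∀ x, affine j (insertOne i x) = σ (transition (τ x)) ∧ insertOne i x j = (τ x).1)
  fin_cases i <;> fin_cases j <;> simp at hij
  · refine key r r (.inl rfl) (.inl rfl) fun x => ?_
    simp [hr, affine, insertOne, transition, Fin.succAbove, Fin.insertNth,
      Fin.succAboveCases, one_mul']
  · refine key r s (.inl rfl) (.inr rfl) fun x => ?_
    simp [hr, hs, affine, insertOne, transition, Fin.succAbove, Fin.insertNth,
      Fin.succAboveCases, one_mul']
  · refine key r r (.inl rfl) (.inl rfl) fun x => ?_
    simp [hr, affine, insertOne, transition, Fin.succAbove, Fin.insertNth,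
      Fin.succAboveCases, one_mul']
  · refine key s s (.inr rfl) (.inr rfl) fun x => ?_
    simp [hs, affine, insertOne, transition, Fin.succAbove, Fin.insertNth,
      Fin.succAboveCases, one_mul']
  · refine key s r (.inr rfl) (.inl rfl) fun x => ?_
    simp [hr, hs, affine, insertOne, transition, Fin.succAbove, Fin.insertNth,
      Fin.succAboveCases, one_mul']
  · refine key s s (.inr rfl) (.inr rfl) fun x => ?_
    simp [hs, affine, insertOne, transition, Fin.succAbove, Fin.insertNth,
      Fin.succAboveCases, one_mul']

theorem lineElement_affine {i j : Fin 3} {x : Model} (hx : x ∈ domain)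
    (hj : 0 < nsq (insertOne i x j)) (X : Model) :
    lineElement (affine j (insertOne i x)) (fderiv ℝ (fun y => affine j (insertOne i y)) x X)
      = lineElement x X := by
  rcases eq_or_ne i j with rfl | hij
  · have : (fun y => affine i (insertOne i y)) = id := funext fun y => affine_insertOne i y
    rw [this, affine_insertOne, fderiv_id]
    rfl
  obtain ⟨σ, τ, hσ, hτ, h⟩ := affine_insertOne_cases hij
  have inv_of (ρ : Model ≃L[ℝ] Model) (hρ : ρ = .refl ℝ _ ∨ ρ = .prodComm ℝ _ _) (y Y : Model) :
      lineElement (ρ y) (ρ Y) = lineElement y Y := by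
    rcases hρ with rfl | rfl
    · rfl
    · exact lineElement_swap y Y
  have hτd : τ x ∈ domain := by
    rcases hτ with rfl | rfl
    · exact hx
    · have hx' : 0 < 1 + nsq x.1 + nsq x.2 := hx
      change 0 < 1 + nsq x.2 + nsq x.1
      linarith
  have hpos : 0 < nsq (τ x).1 := by rw [← (h x).2]; exact hj
  obtain ⟨L, hL, hL'⟩ := hasFDerivAt_transition hpos
  have h1 : HasFDerivAt (fun y => affine j (insertOne i y))
      ((σ : Model →L[ℝ] Model).comp (L.comp (τ : Model →L[ℝ] Model))) x := by
    have : (fun y => affine j (insertOne i y)) = fun y => σ (transition (τ y)) :=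
      funext fun y => (h y).1
    rw [this]
    exact σ.hasFDerivAt.comp x (hL.comp x τ.hasFDerivAt)
  rw [h1.fderiv, (h x).1]
  change lineElement (σ _) (σ (L (τ X))) = _
  rw [inv_of σ hσ, hL', lineElement_transition hpos hτd, inv_of τ hτ]

/-- The metrics of the three charts agree on the overlaps. -/
theorem chartMetric_eq {i j : Fin 3} {P : ParaOctonionicPlane} (hi : P ∈ chartSource i)
    (hj : P ∈ chartSource j) : chartMetric i P = chartMetric j P := by
  set x := chart i P with hx
  have hPx : (chart i).symm x = P := (chart i).left_inv hi
  have hxd : x ∈ domain := (chart i).map_source hi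
  have hj' : 0 < nsq (insertOne i x j) := (chart_symm_mem hxd).1 (by rw [hPx]; exact hj)
  have hjx : chart j P = affine j (insertOne i x) := by rw [← chart_chart_symm hxd hj', hPx]
  have hdi : HasMFDerivAt 𝓘(ℝ, Model) 𝓘(ℝ, Model) (chart i) P _ :=
    (mdifferentiableAt_atlas (chart_mem_atlas i) hi).hasMFDerivAt
  have hdt : DifferentiableAt ℝ (fun y => affine j (insertOne i y)) x :=
    ((contDiffAt_affine j hj').comp x (contDiff_insertOne i).contDiffAt).differentiableAt
      (by simp)
  have hcomp := HasMFDerivAt.comp P (I' := 𝓘(ℝ, Model)) hdt.hasFDerivAt.hasMFDerivAt hdi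
  have hev : (chart j : ParaOctonionicPlane → Model) =ᶠ[𝓝 P]
      (fun y => affine j (insertOne i y)) ∘ chart i := by
    filter_upwards [(chart i).open_source.mem_nhds hi, (chart j).open_source.mem_nhds hj]
      with Q hQi hQj
    have hQ : (chart i).symm (chart i Q) = Q := (chart i).left_inv hQi
    have hd : chart i Q ∈ domain := (chart i).map_source hQi
    rw [Function.comp_apply, ← chart_chart_symm hd
      ((chart_symm_mem hd).1 (by rw [hQ]; exact hQj)), hQ]
  have hmf := (hcomp.congr_of_eventuallyEq hev).mfderiv
  let d : Model →L[ℝ] Model := mfderiv 𝓘(ℝ, Model) 𝓘(ℝ, Model) (chart i) P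
  let t : Model →L[ℝ] Model := fderiv ℝ (fun y => affine j (insertOne i y)) x
  have hd' : mfderiv 𝓘(ℝ, Model) 𝓘(ℝ, Model) (chart j) P = t.comp d := hmf
  have quad (X : Model) : coordForm (chart j P) (t X) (t X) = coordForm x X X := by
    rw [coordForm_self, coordForm_self, hjx]
    exact lineElement_affine hxd hj' X
  have bil (X Y : Model) : coordForm (chart j P) (t X) (t Y) = coordForm x X Y := by
    have h := quad (X + Y)
    simp only [map_add, _root_.add_apply, quad] at h
    rw [coordForm_symm _ (t Y), coordForm_symm _ Y X] at h
    linarith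
  have e1 : ∀ X Y : Model, chartMetric i P X Y = coordForm x (d X) (d Y) := fun _ _ => rfl
  have e2 : ∀ X Y : Model, chartMetric j P X Y = coordForm (chart j P) (t (d X)) (t (d Y)) := by
    intro X Y
    have e3 : chartMetric j P X Y =
      coordForm (chart j P) (mfderiv 𝓘(ℝ, Model) 𝓘(ℝ, Model) (chart j) P X)
        (mfderiv 𝓘(ℝ, Model) 𝓘(ℝ, Model) (chart j) P Y) := rfl
    rw [e3, hd']
    rfl
  refine ContinuousLinearMap.ext fun X => ContinuousLinearMap.ext fun Y => ?_
  exact (e1 X Y).trans ((bil (d X) (d Y)).symm.trans (e2 X Y).symm)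

/-- In each of the three charts the metric is given by `ds²`. -/
theorem metric_eq {i : Fin 3} {P : ParaOctonionicPlane} (hi : P ∈ chartSource i) :
    metric P = chartMetric i P := chartMetric_eq (mem_chartIndex P) hi

/-- The point `P₀ = [1, 0, 0]`. -/
def basePoint : ParaOctonionicPlane :=
  mk ⟨![1, 0, 0], mem_reduced.2 ⟨⟨0, rfl⟩, by simp [Fin.sum_univ_three, nsq_one, nsq_zero]⟩⟩

/-- The identification `(a, b) ↔ Σ aᵢ eᵢ + Σ bᵢ fᵢ` of pairs of para-octonions with tangent vectors at
`P₀`: the tangent vector with coordinates `(a, b)` in the chart `[1, u, v] ↦ (u, v)`. -/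
def tangentOfPair (a b : ParaOctonion) : TangentSpace 𝓘(ℝ, Model) basePoint :=
  (mfderiv 𝓘(ℝ, Model) 𝓘(ℝ, Model) (chart 0) basePoint).inverse (a, b)

end ParaOctonionicPlane

end

open scoped Quaternion Manifold ContDiff Topology

set_option maxSynthPendingDepth 3

namespace SemiRiemannian

section Coordinates

variable {E : Type*} [NormedAddCommGroup E] [NormedSpace ℝ E] {G G' : E → E →L[ℝ] E →L[ℝ] ℝ} {x : E}

theorem christoffel_eventuallyEq (h : G =ᶠ[𝓝 x] G') (v w : E) :
    (fun y => christoffel G y v w) =ᶠ[𝓝 x] fun y => christoffel G' y v w := by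
  filter_upwards [h, h.fderiv (𝕜 := ℝ)] with y hy hy'
  simp only [christoffel, christoffelLower, hy, hy']

/-- The curvature at a point depends only on the germ of the metric there. -/
theorem coordCurvature_congr (h : G =ᶠ[𝓝 x] G') (X Y Z : E) :
    coordCurvature G x X Y Z = coordCurvature G' x X Y Z := by
  have hc (v w : E) : christoffel G x v w = christoffel G' x v w :=
    (christoffel_eventuallyEq h v w).self_of_nhds
  simp only [coordCurvature, (christoffel_eventuallyEq h _ _).fderiv_eq, hc]

theorem christoffelLower_apply (G : E → E →L[ℝ] E →L[ℝ] ℝ) (x v w z : E) :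
    christoffelLower G x v w z =
      (1 / 2) * (fderiv ℝ G x v w z + fderiv ℝ G x w v z - fderiv ℝ G x z v w) := by
  simp [christoffelLower]

theorem christoffelLower_eq_zero (h : fderiv ℝ G x = 0) (v w : E) :
    christoffelLower G x v w = 0 := by
  ext z
  simp [christoffelLower_apply, h]

theorem christoffel_eq_zero (h : fderiv ℝ G x = 0) (v w : E) : christoffel G x v w = 0 := by
  rw [christoffel, christoffelLower_eq_zero h, map_zero]

theorem differentiableAt_christoffelLower (h : DifferentiableAt ℝ (fderiv ℝ G) x) (v w : E) :
    DifferentiableAt ℝ (fun y => christoffelLower G y v w) x := by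
  let φ := ContinuousLinearMap.flipₗᵢ ℝ E E (E →L[ℝ] ℝ)
  let ψ := ContinuousLinearMap.flipₗᵢ ℝ E E ℝ
  have h₁ : DifferentiableAt ℝ (fun y => ψ (φ (fderiv ℝ G y) v)) x :=
    ψ.differentiableAt.comp x
      ((φ.differentiableAt.comp x h).clm_apply (differentiableAt_const v))
  have h₂ (a b : E) : DifferentiableAt ℝ (fun y => fderiv ℝ G y a b) x :=
    (h.clm_apply (differentiableAt_const a)).clm_apply (differentiableAt_const b)
  exact (((h₂ v w).add (h₂ w v)).sub (h₁.clm_apply (differentiableAt_const w))).const_smul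
    (1 / 2 : ℝ)

theorem fderiv_christoffelLower_apply (h : DifferentiableAt ℝ (fderiv ℝ G) x) (v w p z : E) :
    fderiv ℝ (fun y => christoffelLower G y v w) x p z =
      (1 / 2) * (fderiv ℝ (fderiv ℝ G) x p v w z + fderiv ℝ (fderiv ℝ G) x p w v z
        - fderiv ℝ (fderiv ℝ G) x p z v w) := by
  have h₁ := (differentiableAt_christoffelLower h v w).hasFDerivAt.clm_apply
    (hasFDerivAt_const z x)
  have h₂ (a b c : E) : HasFDerivAt (fun y => fderiv ℝ G y a b c) _ x :=
    ((h.hasFDerivAt.clm_apply (hasFDerivAt_const a x)).clm_apply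
      (hasFDerivAt_const b x)).clm_apply (hasFDerivAt_const c x)
  have h₃ := (((h₂ v w z).add (h₂ w v z)).sub (h₂ z v w)).const_mul (1 / 2)
  have h₄ := h₁.unique (h₃.congr_of_eventuallyEq
    (.of_forall fun y => christoffelLower_apply G y v w z))
  simpa using congrArg (fun L => L p) h₄

/-- The curvature at a point where the first derivatives of the metric vanish. -/
theorem apply_coordCurvature_of_fderiv_eq_zero [CompleteSpace E] (hG : ContDiffAt ℝ 2 G x)
    (hd : fderiv ℝ G x = 0) (hi : (G x).IsInvertible) (X Y Z W : E) :
    G x (coordCurvature G x X Y Z) W =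
      (1 / 2) * (fderiv ℝ (fderiv ℝ G) x Y Z X W - fderiv ℝ (fderiv ℝ G) x Y W X Z
        - fderiv ℝ (fderiv ℝ G) x X Z Y W + fderiv ℝ (fderiv ℝ G) x X W Y Z) := by
  have hD : DifferentiableAt ℝ (fderiv ℝ G) x :=
    (hG.fderiv_right (m := 1) (by norm_num)).differentiableAt one_ne_zero
  have hinv : DifferentiableAt ℝ (fun y => (G y).inverse) x :=
    DifferentiableAt.comp x ((hi.contDiffAt_map_inverse (n := 1)).differentiableAt one_ne_zero)
      (hG.differentiableAt two_ne_zero)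
  have key (v w p : E) : G x (fderiv ℝ (fun y => christoffel G y v w) x p) =
      fderiv ℝ (fun y => christoffelLower G y v w) x p := by
    have := (hinv.hasFDerivAt.clm_apply (differentiableAt_christoffelLower hD v w).hasFDerivAt)
    have h₂ : fderiv ℝ (fun y => christoffel G y v w) x p = _ :=
      congrArg (fun L => L p) this.fderiv
    rw [h₂]
    simp [christoffelLower_eq_zero hd, hi.self_apply_inverse]
  have hsymm : IsSymmSndFDerivAt ℝ G x := hG.isSymmSndFDerivAt (by simp)
  rw [coordCurvature, christoffel_eq_zero hd Y, christoffel_eq_zero hd X, add_zero, sub_zero, map_sub, key, key, _root_.sub_apply,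
    fderiv_christoffelLower_apply hD, fderiv_christoffelLower_apply hD, hsymm.eq Y X]
  ring

end Coordinates

end SemiRiemannian

namespace ParaOctonionicPlane

open ParaOctonion

theorem contDiffOn_coordForm : ContDiffOn ℝ ∞ coordForm domain := by
  refine contDiffOn_clm_apply.2 fun X => contDiffOn_clm_apply.2 fun Y => ?_
  have hu : ContDiff ℝ ∞ (fun x : Model => nsq x.1) := contDiff_nsq.comp contDiff_fst
  have hv : ContDiff ℝ ∞ (fun x : Model => nsq x.2) := contDiff_nsq.comp contDiff_snd
  have hm : ContDiff ℝ ∞ (fun x : Model => x.2 * conj x.1) :=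
    contDiff_mul.comp (contDiff_snd.prodMk (conjL.contDiff.comp contDiff_fst))
  have hr (a b : ParaOctonion) :
      ContDiff ℝ ∞ (fun x : Model => re ((x.1 * conj x.2) * (a * conj b))) := by
    simp only [re_mul_eq_ip]
    exact (ipL.flip (a * conj b)).contDiff.comp hm
  have hN : ContDiff ℝ ∞ (fun x : Model => ip X.1 Y.1 * (1 + nsq x.2) + ip X.2 Y.2 * (1 + nsq x.1)
      - re ((x.1 * conj x.2) * (X.2 * conj Y.1)) - re ((x.1 * conj x.2) * (Y.2 * conj X.1))) :=
    (((contDiff_const.mul (contDiff_const.add hv)).add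
      (contDiff_const.mul (contDiff_const.add hu))).sub (hr _ _)).sub (hr _ _)
  have hD : ContDiff ℝ ∞ (fun x : Model => (1 + nsq x.1 + nsq x.2) ^ 2) :=
    ((contDiff_const.add hu).add hv).pow 2
  exact hN.contDiffOn.div hD.contDiffOn fun x hx => pow_ne_zero 2 (ne_of_gt hx)

/-- The derivative of the numerator of `ds²` at `x` in the direction `v`. -/
noncomputable def numeratorDeriv (x v X Y : Model) : ℝ :=
  2 * ip x.2 v.2 * ip X.1 Y.1 + 2 * ip x.1 v.1 * ip X.2 Y.2
    - re ((x.1 * conj v.2 + v.1 * conj x.2) * (X.2 * conj Y.1 + Y.2 * conj X.1))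

theorem fderiv_coordForm_apply {x : Model} (hx : x ∈ domain) (v X Y : Model) :
    fderiv ℝ coordForm x v X Y =
      numeratorDeriv x v X Y / (1 + nsq x.1 + nsq x.2) ^ 2
        - 4 * (ip x.1 v.1 + ip x.2 v.2) * coordForm x X Y / (1 + nsq x.1 + nsq x.2) := by
  have hd : HasFDerivAt coordForm (fderiv ℝ coordForm x) x :=
    ((contDiffOn_coordForm.contDiffAt (isOpen_domain.mem_nhds hx)).differentiableAt
      (by simp)).hasFDerivAt
  have hl : HasDerivAt (fun t : ℝ => x + t • v) v 0 := by
    simpa using ((hasDerivAt_id (0 : ℝ)).smul_const v).const_add x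
  have h₁ : HasDerivAt (fun t : ℝ => coordForm (x + t • v) X Y) (fderiv ℝ coordForm x v X Y) 0 := by
    have h := (hd.clm_apply (hasFDerivAt_const X x)).clm_apply (hasFDerivAt_const Y x)
    have h' := HasFDerivAt.comp_hasDerivAt_of_eq (0 : ℝ) h hl (by simp)
    exact h'.congr_deriv (by simp)
  set s := 1 + nsq x.1 + nsq x.2 with hs
  have hs0 : s ≠ 0 := ne_of_gt hx
  set N := ip X.1 Y.1 * (1 + nsq x.2) + ip X.2 Y.2 * (1 + nsq x.1)
      - re ((x.1 * conj x.2) * (X.2 * conj Y.1)) - re ((x.1 * conj x.2) * (Y.2 * conj X.1)) with hN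
  set N₂ := ip X.1 Y.1 * nsq v.2 + ip X.2 Y.2 * nsq v.1
      - re ((v.1 * conj v.2) * (X.2 * conj Y.1)) - re ((v.1 * conj v.2) * (Y.2 * conj X.1))
  have h₂ (t : ℝ) : coordForm (x + t • v) X Y = (N + t * numeratorDeriv x v X Y + t ^ 2 * N₂) /
      (s + t * (2 * (ip x.1 v.1 + ip x.2 v.2)) + t ^ 2 * (nsq v.1 + nsq v.2)) ^ 2 := by
    rw [coordForm_apply]
    congr 1
    · simp only [N, N₂, numeratorDeriv, Prod.fst_add, Prod.snd_add, Prod.smul_fst, Prod.smul_snd,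
        nsq_add, nsq_smul, ip_smul_right, conj_add, conj_smul, mul_add', add_mul', ParaOctonion.smul_mul',
        mul_smul', re_add, re_smul]
      ring
    · simp only [s, Prod.fst_add, Prod.snd_add, Prod.smul_fst, Prod.smul_snd, nsq_add, nsq_smul,
        ip_smul_right]
      ring
  have hpoly (a b c : ℝ) : HasDerivAt (fun t : ℝ => a + t * b + t ^ 2 * c) b 0 := by
    exact ((((hasDerivAt_id (0 : ℝ)).mul_const b).const_add a).add
      ((hasDerivAt_pow 2 (0 : ℝ)).mul_const c)).congr_deriv (by simp)
  have h₃ := (hpoly N (numeratorDeriv x v X Y) N₂).div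
    ((hpoly s (2 * (ip x.1 v.1 + ip x.2 v.2)) (nsq v.1 + nsq v.2)).pow 2) (by simpa using hs0)
  rw [h₁.unique (h₃.congr_of_eventuallyEq (.of_forall h₂)), coordForm_apply, ← hN, ← hs]
  simp
  field_simp
  ring

theorem zero_mul' (a : ParaOctonion) : 0 * a = 0 := by
  simpa using ParaOctonion.smul_mul' 0 0 a

theorem ip_zero_left (a : ParaOctonion) : ip 0 a = 0 := by
  simpa using ip_smul_left 0 0 a

theorem coordForm_zero_apply (X Y : Model) :
    coordForm 0 X Y = ip X.1 Y.1 + ip X.2 Y.2 := by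
  have h : re 0 = 0 := rfl
  simp [coordForm_apply, nsq_zero, zero_mul', h]

theorem numeratorDeriv_smul (t : ℝ) (p v X Y : Model) :
    numeratorDeriv (t • p) v X Y = t * numeratorDeriv p v X Y := by
  simp only [numeratorDeriv, Prod.smul_fst, Prod.smul_snd, ip_smul_left, conj_smul, ParaOctonion.smul_mul',
    mul_smul', ← smul_add, re_smul]
  ring

theorem fderiv_coordForm_zero : fderiv ℝ coordForm 0 = 0 := by
  refine ContinuousLinearMap.ext fun v => ContinuousLinearMap.ext fun X =>
    ContinuousLinearMap.ext fun Y => ?_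
  have h := numeratorDeriv_smul 0 0 v X Y
  rw [zero_smul, zero_mul] at h
  rw [fderiv_coordForm_apply zero_mem_domain, h]
  simp [ip_zero_left]

theorem fderiv_fderiv_coordForm_zero_apply (p v X Y : Model) :
    fderiv ℝ (fderiv ℝ coordForm) 0 p v X Y =
      numeratorDeriv p v X Y
        - 4 * (ip p.1 v.1 + ip p.2 v.2) * (ip X.1 Y.1 + ip X.2 Y.2) := by
  have hG := contDiffOn_coordForm.contDiffAt (isOpen_domain.mem_nhds zero_mem_domain)
  have hd : HasFDerivAt (fderiv ℝ coordForm) (fderiv ℝ (fderiv ℝ coordForm) 0) 0 :=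
    ((hG.fderiv_right (m := 1) (by norm_cast)).differentiableAt one_ne_zero).hasFDerivAt
  have hl : HasDerivAt (fun t : ℝ => t • p) p 0 := by
    simpa using (hasDerivAt_id (0 : ℝ)).smul_const p
  have h₁ : HasDerivAt (fun t : ℝ => fderiv ℝ coordForm (t • p) v X Y)
      (fderiv ℝ (fderiv ℝ coordForm) 0 p v X Y) 0 := by
    have h := ((hd.clm_apply (hasFDerivAt_const v 0)).clm_apply
      (hasFDerivAt_const X 0)).clm_apply (hasFDerivAt_const Y 0)
    have h' := HasFDerivAt.comp_hasDerivAt_of_eq (0 : ℝ) h hl (by simp)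
    exact h'.congr_deriv (by simp)
  have h₂ : HasDerivAt (fun t : ℝ => t * (numeratorDeriv p v X Y /
      (1 + nsq (t • p).1 + nsq (t • p).2) ^ 2 - 4 * (ip p.1 v.1 + ip p.2 v.2) *
        coordForm (t • p) X Y / (1 + nsq (t • p).1 + nsq (t • p).2)))
      (numeratorDeriv p v X Y
        - 4 * (ip p.1 v.1 + ip p.2 v.2) * (ip X.1 Y.1 + ip X.2 Y.2)) 0 := by
    have hc : ContinuousAt (fun x : Model => numeratorDeriv p v X Y /
      (1 + nsq x.1 + nsq x.2) ^ 2 - 4 * (ip p.1 v.1 + ip p.2 v.2) *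
        coordForm x X Y / (1 + nsq x.1 + nsq x.2)) 0 := by
      have hs : ContinuousAt (fun x : Model => 1 + nsq x.1 + nsq x.2) 0 :=
        ((continuous_const.add (continuous_nsq.comp continuous_fst)).add
          (continuous_nsq.comp continuous_snd)).continuousAt
      have hf : ContinuousAt (fun x : Model => coordForm x X Y) 0 :=
        (hG.continuousAt.clm_apply continuousAt_const).clm_apply continuousAt_const
      exact (continuousAt_const.div (hs.pow 2) (by simp [nsq_zero])).sub
        ((continuousAt_const.mul hf).div hs (by simp [nsq_zero]))
    have hc' := ContinuousAt.comp_of_eq hc hl.continuousAt (by simp)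
    rw [hasDerivAt_iff_tendsto_slope_zero]
    have h := hc'.tendsto.mono_left (nhdsWithin_le_nhds (s := {0}ᶜ))
    simp only [Function.comp_apply, zero_smul, coordForm_zero_apply, Prod.fst_zero, Prod.snd_zero,
      nsq_zero, add_zero, one_pow, div_one] at h
    refine h.congr' ?_
    filter_upwards [self_mem_nhdsWithin] with t ht
    rw [zero_mul, sub_zero, zero_add, smul_eq_mul, inv_mul_cancel_left₀ ht]
    rfl
  refine h₁.unique (h₂.congr_of_eventuallyEq ?_)
  filter_upwards [hl.continuousAt.preimage_mem_nhds
    (by simpa using isOpen_domain.mem_nhds zero_mem_domain)] with t ht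
  rw [fderiv_coordForm_apply ht, numeratorDeriv_smul]
  simp only [Prod.smul_fst, Prod.smul_snd, ip_smul_left]
  ring

theorem eq_zero_of_forall_ip {a : ParaOctonion} (h : ∀ b, ip a b = 0) : a = 0 := by
  have h₁ := (ip_eq _ _).symm.trans (h (a.1, -a.2))
  change a.1.re * a.1.re + a.1.imI * a.1.imI + a.1.imJ * a.1.imJ + a.1.imK * a.1.imK
    - a.2.re * -a.2.re - a.2.imI * -a.2.imI - a.2.imJ * -a.2.imJ - a.2.imK * -a.2.imK = 0 at h₁
  have hq (q : ℍ[ℝ]) (hq : q.re ^ 2 + q.imI ^ 2 + q.imJ ^ 2 + q.imK ^ 2 ≤ 0) : q = 0 := by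
    have : Quaternion.normSq q = 0 :=
      le_antisymm (by rw [Quaternion.normSq_def']; exact hq) Quaternion.normSq_nonneg
    exact Quaternion.normSq_eq_zero.1 this
  exact Prod.ext
    (hq _ (by nlinarith [sq_nonneg a.2.re, sq_nonneg a.2.imI, sq_nonneg a.2.imJ, sq_nonneg a.2.imK]))
    (hq _ (by nlinarith [sq_nonneg a.1.re, sq_nonneg a.1.imI, sq_nonneg a.1.imJ, sq_nonneg a.1.imK]))

theorem isInvertible_coordForm_zero : (coordForm 0).IsInvertible := by
  have hinj : Function.Injective (coordForm 0 : Model →ₗ[ℝ] Model →L[ℝ] ℝ) := by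
    refine (injective_iff_map_eq_zero _).2 fun X hX => ?_
    have h (Y : Model) : ip X.1 Y.1 + ip X.2 Y.2 = 0 := by
      rw [← coordForm_zero_apply]
      exact congrArg (fun L : Model →L[ℝ] ℝ => L Y) hX
    have h0 (a : ParaOctonion) : ip a 0 = 0 := by rw [ip_comm, ip_zero_left]
    exact Prod.ext (eq_zero_of_forall_ip fun b => by simpa [h0] using h (b, 0))
      (eq_zero_of_forall_ip fun b => by simpa [h0] using h (0, b))
  have hrank : Module.finrank ℝ Model = Module.finrank ℝ (Model →L[ℝ] ℝ) := by
    rw [← (LinearMap.toContinuousLinearMap (𝕜 := ℝ) (E := Model) (F' := ℝ)).finrank_eq]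
    exact Subspace.dual_finrank_eq.symm
  let e := LinearEquiv.ofInjectiveOfFinrankEq _ hinj hrank
  exact ⟨e.toContinuousLinearEquiv, ContinuousLinearMap.ext fun _ => rfl⟩

theorem basePoint_mem_chartSource : basePoint ∈ chartSource 0 :=
  mk_mem_chartSource.2 (by simp [nsq_one])

theorem chartIndex_basePoint : chartIndex basePoint = 0 := by
  classical
  exact (Fin.find_eq_iff _).2 ⟨basePoint_mem_chartSource, fun j hj => absurd hj (Fin.not_lt_zero j)⟩

theorem chart_basePoint : chart 0 basePoint = 0 := by
  rw [chart_apply, basePoint, chartFun_mk (by simp [nsq_one])]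
  simp [affine, zero_mul', Fin.succAbove]

theorem mdifferentiable_chart (i : Fin 3) :
    (chart i).MDifferentiable 𝓘(ℝ, Model) 𝓘(ℝ, Model) :=
  mdifferentiable_of_mem_atlas (chart_mem_atlas i)

/-- In the coordinates of each chart, the metric is given by `ds²`. -/
theorem inChart_metric (i : Fin 3) {x : Model} (hx : x ∈ domain) :
    SemiRiemannian.inChart metric (chart i) x = coordForm x := by
  have hmem : (chart i).symm x ∈ chartSource i := (chart i).map_target hx
  have hinv : chart i ((chart i).symm x) = x := (chart i).right_inv hx
  have hd := (mdifferentiable_chart i).comp_symm_deriv hx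
  have hd' (X : Model) : mfderiv 𝓘(ℝ, Model) 𝓘(ℝ, Model) (chart i) ((chart i).symm x)
      (mfderiv 𝓘(ℝ, Model) 𝓘(ℝ, Model) (chart i).symm x X) = X :=
    congrArg (fun L : Model →L[ℝ] Model => L X) hd
  refine ContinuousLinearMap.ext fun X => ContinuousLinearMap.ext fun Y => ?_
  rw [SemiRiemannian.inChart, metric_eq hmem]
  change coordForm (chart i ((chart i).symm x))
    (mfderiv 𝓘(ℝ, Model) 𝓘(ℝ, Model) (chart i) ((chart i).symm x)
      (mfderiv 𝓘(ℝ, Model) 𝓘(ℝ, Model) (chart i).symm x X))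
    (mfderiv 𝓘(ℝ, Model) 𝓘(ℝ, Model) (chart i) ((chart i).symm x)
      (mfderiv 𝓘(ℝ, Model) 𝓘(ℝ, Model) (chart i).symm x Y)) = _
  rw [hd', hd', hinv]

theorem mfderiv_chart_tangentOfPair (a b : ParaOctonion) :
    mfderiv 𝓘(ℝ, Model) 𝓘(ℝ, Model) (chart 0) basePoint (tangentOfPair a b) = (a, b) := by
  have h : (mfderiv 𝓘(ℝ, Model) 𝓘(ℝ, Model) (chart 0) basePoint).IsInvertible :=
    ⟨(mdifferentiable_chart 0).mfderiv basePoint_mem_chartSource, rfl⟩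
  exact h.self_apply_inverse _

theorem riemannTensor_basePoint (a b c d e f g h : ParaOctonion) :
    SemiRiemannian.riemannTensor metric basePoint
        (tangentOfPair a b) (tangentOfPair c d) (tangentOfPair e f) (tangentOfPair g h) =
      coordForm 0 (SemiRiemannian.coordCurvature coordForm 0 (a, b) (c, d) (e, f)) (g, h) := by
  have hc : chartAt Model basePoint = chart 0 := congrArg chart chartIndex_basePoint
  have hev : SemiRiemannian.inChart metric (chart 0) =ᶠ[𝓝 0] coordForm := by
    filter_upwards [isOpen_domain.mem_nhds zero_mem_domain] with x hx
    exact inChart_metric 0 hx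
  rw [SemiRiemannian.riemannTensor, hc]
  simp only [chart_basePoint]
  rw [SemiRiemannian.coordCurvature_congr hev, inChart_metric 0 zero_mem_domain]
  have key (X Y Z W : Model) (hX : X = (a, b)) (hY : Y = (c, d)) (hZ : Z = (e, f))
      (hW : W = (g, h)) : coordForm 0 (SemiRiemannian.coordCurvature coordForm 0 X Y Z) W =
        coordForm 0 (SemiRiemannian.coordCurvature coordForm 0 (a, b) (c, d) (e, f)) (g, h) := by
    rw [hX, hY, hZ, hW]
  exact key _ _ _ _ (mfderiv_chart_tangentOfPair a b) (mfderiv_chart_tangentOfPair c d)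
    (mfderiv_chart_tangentOfPair e f) (mfderiv_chart_tangentOfPair g h)

/-- The curvature of `ds²` at the origin. -/
theorem coordForm_coordCurvature_zero (a b c d e f g h : ParaOctonion) :
    coordForm 0 (SemiRiemannian.coordCurvature coordForm 0 (a, b) (c, d) (e, f)) (g, h) =
      4 * (ip a e * ip c g) - 4 * (ip c e * ip a g)
        + 4 * (ip b f * ip d h) - 4 * (ip d f * ip b h)
        - ip (e * conj d) (g * conj b) + ip (e * conj b) (g * conj d)
        - ip (c * conj f) (a * conj h) + ip (a * conj f) (c * conj h)
        - ip (a * conj d - c * conj b) (g * conj f - e * conj h) := by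
  have hG : ContDiffAt ℝ 2 coordForm 0 :=
    (contDiffOn_coordForm.contDiffAt (isOpen_domain.mem_nhds zero_mem_domain)).of_le
      (by norm_cast)
  have hre (p q r s : ParaOctonion) :
      re ((p * conj q) * (r * conj s)) = ip (p * conj q) (s * conj r) := by
    rw [re_mul_eq_ip, ← ip_conj_conj, ParaOctonion.conj_mul, ParaOctonion.conj_mul,
      ParaOctonion.conj_conj, ParaOctonion.conj_conj]
  have hsub (p q : ParaOctonion) : p - q = p + (-1 : ℝ) • q := by simp [sub_eq_add_neg]
  have hx (p q r s : ParaOctonion) : ip (p * conj q) (r * conj s) + ip (p * conj s) (r * conj q) =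
      2 * ip p r * ip q s := by rw [ip_exchange, ip_conj_conj]
  rw [SemiRiemannian.apply_coordCurvature_of_fderiv_eq_zero hG
    fderiv_coordForm_zero isInvertible_coordForm_zero]
  simp only [fderiv_fderiv_coordForm_zero_apply, numeratorDeriv,
    add_mul', mul_add', re_add, hre, hsub, ip_add_left, ip_add_right, ip_smul_left, ip_smul_right]
  have hac := hx a f c h
  have hae := hx a d e h
  have hag := hx a d g f
  have hce := hx c b e h
  have hcg := hx c b g f
  have heg := hx e b g d
  simp only [ip_comm] at hac hae hag hce hcg heg ⊢
  linarith

end ParaOctonionicPlane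

theorem corollaryR (a b c d e f g h : ParaOctonion) :
    SemiRiemannian.riemannTensor ParaOctonionicPlane.metric ParaOctonionicPlane.basePoint
        (ParaOctonionicPlane.tangentOfPair a b) (ParaOctonionicPlane.tangentOfPair c d)
        (ParaOctonionicPlane.tangentOfPair e f) (ParaOctonionicPlane.tangentOfPair g h) =
      4 * (ParaOctonion.ip a e * ParaOctonion.ip c g)
        - 4 * (ParaOctonion.ip c e * ParaOctonion.ip a g)
        + 4 * (ParaOctonion.ip b f * ParaOctonion.ip d h)
        - 4 * (ParaOctonion.ip d f * ParaOctonion.ip b h)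
        - ParaOctonion.ip (e * d.conj) (g * b.conj) + ParaOctonion.ip (e * b.conj) (g * d.conj)
        - ParaOctonion.ip (c * f.conj) (a * h.conj) + ParaOctonion.ip (a * f.conj) (c * h.conj)
        - ParaOctonion.ip (a * d.conj - c * b.conj) (g * f.conj - e * h.conj) := by
  exact (ParaOctonionicPlane.riemannTensor_basePoint a b c d e f g h).trans
    (ParaOctonionicPlane.coordForm_coordCurvature_zero a b c d e f g h)
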